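/- Let $H$ be a complex Hilbert space with $\dim H>1$, and let $\mathcal B_s(H)$ be the set of all self-adjoint bounded linear operators on $H$, ordered by $A\le B$ if and only if $\langle Ax,x\rangle\le\langle Bx,x\rangle$ for every $x\in H$. Let $\phi:\mathcal B_s(H)\to\mathcal B_s(H)$ be a bijective map (no linearity or continuity is assumed) such that $$A\le B\iff\phi(A)\le\phi(B)\qquad\text{for all }A,B\in\mathcal B_s(H).$$ Then there exist an operator $X\in\mathcal B_s(H)$ and an invertible bounded operator $T:H\to H$, either linear or conjugate-linear, such that $$\phi(A)=TAT^*+X\qquad\text{for all }A\in\mathcal B_s(H).$$ Here, for conjugate-linear $T$, the adjoint $T^*$ is the conjugate-linear bounded operator determined by $\langle Tx,y\rangle=\langle T^*y,x\rangle$ for all $x,y\in H$. -/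

import Mathlib

open scoped InnerProductSpace

noncomputable section

/-- The adjoint `T*` of a bounded conjugate-linear operator `T` on a complex Hilbert space: the
bounded conjugate-linear operator with `⟪T* y, x⟫ = ⟪T x, y⟫` for all `x`, `y`
(see `conjAdjoint_inner_left`). For fixed `y` it is the Riesz representative of the bounded
complex-linear functional `x ↦ ⟪T x, y⟫`. (Mathlib's inner product is conjugate-linear in the
first variable.) -/
def conjAdjoint {H : Type*} [NormedAddCommGroup H] [InnerProductSpace ℂ H] [CompleteSpace H]
    (T : H →L⋆[ℂ] H) : H →L⋆[ℂ] H :=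
  ((InnerProductSpace.toDual ℂ H).symm : StrongDual ℂ H →L⋆[ℂ] H).comp
    (((innerSL ℂ : H →L⋆[ℂ] H →L[ℂ] ℂ).comp T).flip)

theorem conjAdjoint_inner_left {H : Type*} [NormedAddCommGroup H] [InnerProductSpace ℂ H]
    [CompleteSpace H] (T : H →L⋆[ℂ] H) (x y : H) :
    ⟪conjAdjoint T y, x⟫_ℂ = ⟪T x, y⟫_ℂ := by
  simp [conjAdjoint]

end

/-! The order detects rank one: for `A ≤ B`, the interval from `A` to `B` is a chain exactly when `B
- A = P x` for some `x`. So `φ` carries lines with rank-one direction onto such lines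
(`map_line_onto`), and the image direction does not depend on the base point (`map_add_mem_dir`).
Because `dim H > 1`, comparing directions makes increments along a line additive, and monotonicity
makes them linear: `φ (A + t • P x) = φ A + t • dir φ x` (`map_add_smul_P`).

Real linear relations between the operators `P x` therefore pass to `dir φ x`, which makes `x ↦ dir
φ x` a quadratic map with rank-one values. Comparing coefficients in pencils of such values gives
`dir φ x = P (T x)` with `T` linear or conjugate-linear (`exists_linear_or_conjLinear`). Finally, a
positive operator is determined by the rank-one operators below it, so its form can be transported
through `T` (`qf_increment`); translation extends this to all self-adjoint operators. -/

/-! ### Quadratic forms and rank-one operators -/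

/-- The bounded self-adjoint operators on `H`, as an ordered real vector space. -/
def SAOp (H : Type*) [NormedAddCommGroup H] [InnerProductSpace ℂ H] [CompleteSpace H] : Type _ :=
  selfAdjoint (H →L[ℂ] H)

namespace SAOp

variable {H : Type*} [NormedAddCommGroup H] [InnerProductSpace ℂ H] [CompleteSpace H]

noncomputable instance : AddCommGroup (SAOp H) :=
  inferInstanceAs (AddCommGroup (selfAdjoint (H →L[ℂ] H)))

noncomputable instance : Module ℝ (SAOp H) :=
  inferInstanceAs (Module ℝ (selfAdjoint (H →L[ℂ] H)))

noncomputable instance : PartialOrder (SAOp H) :=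
  inferInstanceAs (PartialOrder (selfAdjoint (H →L[ℂ] H)))

/-- The underlying bounded operator. -/
def op (A : SAOp H) : H →L[ℂ] H := Subtype.val A

theorem op_isSelfAdjoint (A : SAOp H) : IsSelfAdjoint (op A) := Subtype.property A

@[simp] theorem op_zero : op (0 : SAOp H) = 0 := rfl
@[simp] theorem op_add (A B : SAOp H) : op (A + B) = op A + op B := rfl
@[simp] theorem op_sub (A B : SAOp H) : op (A - B) = op A - op B := rfl
@[simp] theorem op_smul (t : ℝ) (A : SAOp H) : op (t • A) = (t : ℂ) • op A := by
  ext z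
  change t • (op A z) = (t : ℂ) • (op A z)
  simp

/-- The quadratic form of a self-adjoint operator. -/
noncomputable def qf (A : SAOp H) (z : H) : ℝ := (⟪z, op A z⟫_ℂ).re

/-- The rank-one operator `z ↦ ⟪x, z⟫ x`. -/
noncomputable def P (x : H) : SAOp H :=
  ⟨InnerProductSpace.rankOne ℂ x x, by
    rw [selfAdjoint.mem_iff, ContinuousLinearMap.star_eq_adjoint]; simp⟩

theorem P_apply (x z : H) : op (P x) z = ⟪x, z⟫_ℂ • x := rfl

theorem inner_symm (A : SAOp H) (x y : H) : ⟪op A x, y⟫_ℂ = ⟪x, op A y⟫_ℂ := by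
  have h := ContinuousLinearMap.adjoint_inner_left (op A) y x
  rwa [← ContinuousLinearMap.star_eq_adjoint, (op_isSelfAdjoint A).star_eq] at h

theorem inner_self_eq_qf (A : SAOp H) (z : H) : ⟪z, op A z⟫_ℂ = (qf A z : ℂ) := by
  apply Complex.ext
  · simp [qf]
  · have h := inner_conj_symm (𝕜 := ℂ) z (op A z)
    rw [inner_symm] at h
    simpa using Complex.conj_eq_iff_im.1 h

@[simp] theorem qf_zero (z : H) : qf (0 : SAOp H) z = 0 := by simp [qf]
@[simp] theorem qf_add (A B : SAOp H) (z : H) : qf (A + B) z = qf A z + qf B z := by simp [qf]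
@[simp] theorem qf_sub (A B : SAOp H) (z : H) : qf (A - B) z = qf A z - qf B z := by simp [qf]
@[simp] theorem qf_smul (t : ℝ) (A : SAOp H) (z : H) : qf (t • A) z = t * qf A z := by
  simp [qf]

@[simp] theorem qf_P (x z : H) : qf (P x) z = ‖⟪x, z⟫_ℂ‖ ^ 2 := by
  have h : ⟪z, ⟪x, z⟫_ℂ • x⟫_ℂ = ((‖⟪x, z⟫_ℂ‖ ^ 2 : ℝ) : ℂ) := by
    rw [inner_smul_right, ← inner_conj_symm z x, Complex.mul_conj, Complex.normSq_eq_norm_sq]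
  rw [qf, P_apply, h, Complex.ofReal_re]

theorem le_iff {A B : SAOp H} : A ≤ B ↔ ∀ z, qf A z ≤ qf B z := by
  change op A ≤ op B ↔ _
  rw [ContinuousLinearMap.le_def, ContinuousLinearMap.isPositive_def']
  have hs : IsSelfAdjoint (op B - op A) := (op_isSelfAdjoint B).sub (op_isSelfAdjoint A)
  simp only [hs, true_and]
  refine forall_congr' fun z => ?_
  rw [← sub_nonneg (a := qf B z), ← qf_sub]
  rw [ContinuousLinearMap.reApplyInnerSelf, inner_re_symm]
  rfl

instance : IsOrderedAddMonoid (SAOp H) where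
  add_le_add_left A B h C := le_iff.2 fun z => by simpa using le_iff.1 h z

theorem ext_qf {A B : SAOp H} (h : ∀ z, qf A z = qf B z) : A = B :=
  le_antisymm (le_iff.2 fun z => (h z).le) (le_iff.2 fun z => (h z).ge)

theorem nonneg_iff {A : SAOp H} : 0 ≤ A ↔ ∀ z, 0 ≤ qf A z := by simp [le_iff]

theorem P_nonneg (x : H) : 0 ≤ P x := nonneg_iff.2 fun z => by simp

theorem P_smul (c : ℂ) (x : H) : P (c • x) = (‖c‖ ^ 2) • P x :=
  ext_qf fun z => by simp; ring

@[simp] theorem P_zero : P (0 : H) = 0 := ext_qf fun z => by simp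

theorem P_eq_zero {x : H} : P x = 0 ↔ x = 0 := by
  refine ⟨fun h => ?_, fun h => by simp [h]⟩
  have := congrArg (qf · x) h
  simpa using this

/-- Positive multiples of rank-one operators are rank-one. -/
theorem smul_P {t : ℝ} (ht : 0 ≤ t) (x : H) : t • P x = P ((Real.sqrt t : ℂ) • x) := by
  rw [P_smul]
  simp [Real.sq_sqrt ht]

theorem qf_line (A : SAOp H) (x y : H) (t : ℝ) :
    qf A (x + (t : ℂ) • y) = qf A x + t * (2 * (⟪y, op A x⟫_ℂ).re) + t ^ 2 * qf A y := by
  have h : (⟪x, op A y⟫_ℂ).re = (⟪y, op A x⟫_ℂ).re := by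
    rw [← inner_symm]; exact inner_re_symm (𝕜 := ℂ) _ _
  simp only [qf, map_add, map_smul, inner_add_left, inner_add_right, inner_smul_left,
    inner_smul_right, Complex.add_re, Complex.conj_ofReal, Complex.re_ofReal_mul, h]
  ring

/-- The Cauchy–Schwarz inequality for a positive operator. -/
theorem cauchy_schwarz {A : SAOp H} (hA : 0 ≤ A) (x y : H) :
    ‖⟪y, op A x⟫_ℂ‖ ^ 2 ≤ qf A x * qf A y := by
  -- Rotating `y` by a phase makes the cross term real, so the real discriminant criterion applies.
  obtain ⟨u, hu, hux⟩ : ∃ u : ℂ, ‖u‖ = 1 ∧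
      ⟪u • y, op A x⟫_ℂ = (‖⟪y, op A x⟫_ℂ‖ : ℂ) := by
    set c := ⟪y, op A x⟫_ℂ
    by_cases hc : c = 0
    · exact ⟨1, by simp, by simp [c, hc]⟩
    · refine ⟨c / ‖c‖, by simp [hc], ?_⟩
      have h0 : (‖c‖ : ℂ) ≠ 0 := by simpa using hc
      rw [inner_smul_left]
      change _ * c = _
      simp only [map_div₀, Complex.conj_ofReal]
      field_simp
      rw [mul_comm, Complex.mul_conj, Complex.normSq_eq_norm_sq]; simp
  have hq : qf A (u • y) = qf A y := by
    have : ⟪u • y, op A (u • y)⟫_ℂ = ⟪y, op A y⟫_ℂ := by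
      rw [map_smul, inner_smul_left, inner_smul_right, ← mul_assoc, mul_comm _ u, Complex.mul_conj,
        Complex.normSq_eq_norm_sq, hu]
      rw [one_pow, Complex.ofReal_one, one_mul]
    rw [qf, this, qf]
  have h := discrim_le_zero (a := qf A y)
    (b := 2 * ‖⟪y, op A x⟫_ℂ‖) (c := qf A x) fun t => by
      have h1 := nonneg_iff.1 hA (x + (t : ℂ) • (u • y))
      rw [qf_line, hux, hq, Complex.ofReal_re] at h1
      nlinarith
  rw [discrim] at h
  nlinarith

theorem apply_eq_zero {A : SAOp H} (hA : 0 ≤ A) {x : H} (hx : qf A x = 0) :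
    op A x = 0 := by
  have h := cauchy_schwarz hA x (op A x)
  rw [hx, zero_mul] at h
  have : ‖⟪op A x, op A x⟫_ℂ‖ = 0 := by
    nlinarith [norm_nonneg ⟪op A x, op A x⟫_ℂ]
  simpa using this

/-- For `A ≥ 0`, the operator `P (A x) / ⟪A x, x⟫` lies below `A`. -/
theorem smul_P_apply_le {A : SAOp H} (hA : 0 ≤ A) {x : H} (hx : 0 < qf A x) :
    (qf A x)⁻¹ • P (op A x) ≤ A := by
  refine le_iff.2 fun z => ?_
  have h := cauchy_schwarz hA x z
  rw [norm_inner_symm] at h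
  rw [qf_smul, qf_P, inv_mul_le_iff₀ hx]
  exact h

theorem exists_qf_pos {A : SAOp H} (hA : 0 ≤ A) (h0 : A ≠ 0) : ∃ x, 0 < qf A x := by
  by_contra! h
  exact h0 (ext_qf fun z => by simpa using le_antisymm (h z) (nonneg_iff.1 hA z))

/-- A positive operator whose form vanishes on `x^⊥` is a multiple of `P x`. -/
theorem eq_smul_P {C : SAOp H} (hC : 0 ≤ C) {x : H} (hx : x ≠ 0)
    (h : ∀ z, ⟪x, z⟫_ℂ = 0 → qf C z = 0) : C = (qf C x / ‖x‖ ^ 4) • P x := by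
  refine ext_qf fun y => ?_
  have hn : (‖x‖ : ℂ) ≠ 0 := by simpa using hx
  have hn' : ‖x‖ ≠ 0 := by simpa using hx
  set c : ℂ := ⟪x, y⟫_ℂ / ‖x‖ ^ 2 with hc
  set z := y - c • x with hz
  have hxz : ⟪x, z⟫_ℂ = 0 := by
    rw [hz, inner_sub_right, inner_smul_right, inner_self_eq_norm_sq_to_K, hc]
    simp; field_simp; simp
  have hCz := apply_eq_zero hC (h z hxz)
  have hy : y = c • x + z := by simp [hz]
  have h1 : ⟪y, op C y⟫_ℂ = ((‖c‖ ^ 2 * qf C x : ℝ) : ℂ) := by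
    rw [hy, map_add, hCz, add_zero, inner_add_left, ← inner_symm C z, hCz, inner_zero_left,
      add_zero, map_smul, inner_smul_left, inner_smul_right, inner_self_eq_qf, ← mul_assoc,
      mul_comm _ c, Complex.mul_conj, Complex.normSq_eq_norm_sq]
    simp
  rw [qf, h1, Complex.ofReal_re, qf_smul, qf_P, hc]
  simp only [norm_div, norm_pow, Complex.norm_real, norm_norm]
  field_simp

/-! ### Order intervals that are chains -/

/-- The order interval below a rank-one operator consists of its multiples. -/
theorem eq_add_smul_P {A C : SAOp H} {x : H} (h1 : A ≤ C) (h2 : C ≤ A + P x) :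
    ∃ s : ℝ, C = A + s • P x := by
  by_cases hx : x = 0
  · refine ⟨0, ?_⟩
    subst hx
    simpa using le_antisymm (by simpa using h2) h1
  · have := eq_smul_P (C := C - A) (sub_nonneg.2 h1) hx fun z hz => ?_
    · exact ⟨_, by rw [← this]; abel⟩
    · have a := le_iff.1 h1 z
      have b := le_iff.1 h2 z
      simp [hz] at b
      simp; linarith

/-- Order intervals that are chains are spanned by a rank-one operator. -/
theorem exists_eq_add_P {A B : SAOp H} (hAB : A ≤ B)
    (hch : ∀ C D, A ≤ C → C ≤ B → A ≤ D → D ≤ B → C ≤ D ∨ D ≤ C) : ∃ x, B = A + P x := by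
  set R := B - A with hR
  have hR0 : 0 ≤ R := sub_nonneg.2 hAB
  have hB : B = A + R := by simp [hR]
  by_cases hz : R = 0
  · exact ⟨0, by simp [hB, hz]⟩
  obtain ⟨x, hx⟩ := exists_qf_pos hR0 hz
  have hV := smul_P_apply_le hR0 hx
  set V := (qf R x)⁻¹ • P (op R x) with hVdef
  have hVP : ∃ v, V = P v := ⟨_, smul_P (inv_nonneg.2 hx.le) _⟩
  have hV0 : 0 ≤ V := by obtain ⟨v, hv⟩ := hVP; rw [hv]; exact P_nonneg v
  have hVx : qf V x = qf R x := by
    rw [hVdef, qf_smul, qf_P, inner_symm, inner_self_eq_qf]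
    simp; field_simp
  suffices R = V by obtain ⟨v, hv⟩ := hVP; exact ⟨v, by rw [hB, this, hv]⟩
  -- `V` agrees with `R` at `x`. A nonzero remainder `R - V` kills `x` and dominates a rank-one `W`,
  -- which is incomparable with `V`: the form of `W` vanishes at `x`, and that of `V` at `y + c •
  -- x`.
  by_contra hne
  have hR' : 0 ≤ R - V := sub_nonneg.2 hV
  obtain ⟨y, hy⟩ := exists_qf_pos hR' (sub_ne_zero.2 hne)
  have hRx : op (R - V) x = 0 := apply_eq_zero hR' (by simp [hVx])
  have hRxR : ⟪op R x, x⟫_ℂ ≠ 0 := by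
    rw [inner_symm, inner_self_eq_qf]; exact_mod_cast hx.ne'
  obtain ⟨c, hc⟩ : ∃ c : ℂ, ⟪op R x, y + c • x⟫_ℂ = 0 :=
    ⟨-⟪op R x, y⟫_ℂ / ⟪op R x, x⟫_ℂ, by
      rw [inner_add_right, inner_smul_right]; field_simp; simp⟩
  have hW := smul_P_apply_le hR' hy
  set W := (qf (R - V) y)⁻¹ • P (op (R - V) y) with hWdef
  have hW0 : 0 ≤ W := by rw [hWdef, smul_P (inv_nonneg.2 hy.le)]; exact P_nonneg _
  have hin : ⟪op (R - V) y, x⟫_ℂ = 0 := by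
    rw [inner_symm, hRx, inner_zero_right]
  have hWR : W ≤ R := hW.trans (sub_le_self _ hV0)
  have key : V ≤ W ∨ W ≤ V := by
    have := hch (A + V) (A + W) (by simpa using hV0) (by rw [hB]; simpa using hV)
      (by simpa using hW0) (by rw [hB]; simpa using hWR)
    simpa using this
  rcases key with h | h
  · have := le_iff.1 h x
    rw [hVx, hWdef, qf_smul, qf_P, hin] at this
    simp at this; linarith
  · have := le_iff.1 h (y + c • x)
    rw [hVdef, hWdef, qf_smul, qf_smul, qf_P, qf_P, hc, inner_add_right, inner_smul_right, hin,
      inner_symm, inner_self_eq_qf] at this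
    simp only [mul_zero, add_zero, Complex.norm_real, Real.norm_eq_abs, sq_abs] at this
    have h2 : 0 < (qf (R - V) y)⁻¹ * qf (R - V) y ^ 2 := by positivity
    simp only [norm_zero, ne_eq, OfNat.ofNat_ne_zero, not_false_eq_true, zero_pow, mul_zero] at this
    exact absurd this h2.not_ge

/-- The identity operator. -/
noncomputable def one : SAOp H := (1 : selfAdjoint (H →L[ℂ] H))

theorem qf_one (z : H) : qf (one : SAOp H) z = ‖z‖ ^ 2 := by
  change (⟪z, z⟫_ℂ).re = _
  simp [inner_self_eq_norm_sq_to_K, ← Complex.ofReal_pow]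

theorem qf_le_norm (A : SAOp H) (z : H) : qf A z ≤ ‖op A‖ * ‖z‖ ^ 2 := by
  calc qf A z ≤ ‖⟪z, op A z⟫_ℂ‖ := Complex.re_le_norm _
    _ ≤ ‖z‖ * ‖op A z‖ := norm_inner_le_norm _ _
    _ ≤ ‖z‖ * (‖op A‖ * ‖z‖) := by gcongr; exact (op A).le_opNorm z
    _ = _ := by ring

theorem exists_upper_bound (A B : SAOp H) : ∃ D, A ≤ D ∧ B ≤ D := by
  refine ⟨(‖op A‖ + ‖op B‖) • (one : SAOp H), le_iff.2 fun z => ?_, le_iff.2 fun z => ?_⟩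
  · rw [qf_smul, qf_one]
    exact (qf_le_norm A z).trans (by gcongr; linarith [norm_nonneg (op B)])
  · rw [qf_smul, qf_one]
    exact (qf_le_norm B z).trans (by gcongr; linarith [norm_nonneg (op A)])

end SAOp

/-! ### Order isomorphisms along rank-one lines -/

theorem Monotone.eq_mul_of_additive {f : ℝ → ℝ} (hf : Monotone f)
    (hadd : ∀ s t, f (s + t) = f s + f t) (t : ℝ) : f t = t * f 1 := by
  have hc : Continuous (AddMonoidHom.mk' f hadd) :=
    MeasureTheory.Measure.AddMonoidHom.continuous_of_measurable _ hf.measurable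
  simpa using map_real_smul (AddMonoidHom.mk' f hadd) hc t 1

namespace SAOp

variable {H : Type*} [NormedAddCommGroup H] [InnerProductSpace ℂ H] [CompleteSpace H]

theorem line_mono (A : SAOp H) (x : H) : Monotone fun t : ℝ => A + t • P x := fun s t hst =>
  le_iff.2 fun z => by
    simp only [qf_add, qf_smul, qf_P]
    gcongr

theorem exists_eq_smul_of_P_eq {x y : H} {c : ℝ} (h : P x = c • P y) : ∃ d : ℂ, x = d • y := by
  by_cases hx : x = 0
  · exact ⟨0, by simp [hx]⟩
  have h1 := congrArg (fun A => op A x) h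
  simp only [op_smul, P_apply, _root_.smul_apply] at h1
  have h0 : ⟪x, x⟫_ℂ ≠ 0 := by simpa using hx
  refine ⟨(⟪x, x⟫_ℂ)⁻¹ * (c * ⟪y, x⟫_ℂ), ?_⟩
  rw [mul_smul, mul_smul, ← h1, inv_smul_smul₀ h0]

theorem P_add_add_P_sub (x y : H) : P (x + y) + P (x - y) = (2 : ℝ) • P x + (2 : ℝ) • P y :=
  ext_qf fun z => by
    have := parallelogram_law_with_norm ℂ ⟪x, z⟫_ℂ ⟪y, z⟫_ℂ
    simp only [qf_add, qf_P, qf_smul, inner_add_left, inner_sub_left]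
    linarith

section OrderIso

variable (φ : SAOp H ≃o SAOp H)

theorem map_segment (A : SAOp H) (x : H) : ∃ y, φ (A + P x) = φ A + P y ∧
    ∀ C, A ≤ C → C ≤ A + P x → ∃ s : ℝ, φ C = φ A + s • P y := by
  have hle : A ≤ A + P x := le_add_of_nonneg_right (P_nonneg x)
  obtain ⟨y, hy⟩ := exists_eq_add_P (φ.monotone hle) fun C D hC1 hC2 hD1 hD2 => by
    obtain ⟨s, hs⟩ := eq_add_smul_P (φ.le_symm_apply.2 hC1) (φ.symm_apply_le.2 hC2)
    obtain ⟨t, ht⟩ := eq_add_smul_P (φ.le_symm_apply.2 hD1) (φ.symm_apply_le.2 hD2)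
    rw [← φ.symm.le_iff_le, ← φ.symm.le_iff_le (x := D), hs, ht]
    exact (le_total s t).imp (fun h => line_mono A x h) fun h => line_mono A x h
  exact ⟨y, hy, fun C h1 h2 => eq_add_smul_P (φ.monotone h1) (hy ▸ φ.monotone h2)⟩

theorem map_line (A : SAOp H) (x : H) : ∃ y, φ (A + P x) = φ A + P y ∧
    ∀ t : ℝ, ∃ s : ℝ, φ (A + t • P x) = φ A + s • P y := by
  obtain ⟨y, hy, -⟩ := map_segment φ A x
  refine ⟨y, hy, fun t => ?_⟩
  by_cases hx : x = 0
  · exact ⟨0, by simp [hx]⟩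
  -- One segment is chosen to contain the parameters `0`, `1` and `t`; the images at `0` and `1`
  -- then identify its image direction with that of `y`.
  have hlen : 0 ≤ max t 1 - min t 0 := by
    have := le_max_right t 1; have := min_le_right t 0; linarith
  obtain ⟨y', -, h⟩ := map_segment φ (A + min t 0 • P x)
    ((Real.sqrt (max t 1 - min t 0) : ℂ) • x)
  rw [← smul_P hlen, add_assoc, ← add_smul, add_sub_cancel] at h
  obtain ⟨s, hs⟩ := h (A + t • P x) (line_mono A x (min_le_left _ _))
    (line_mono A x (le_max_left _ _))
  obtain ⟨s₀, hs₀⟩ := h A (by simpa using line_mono A x (min_le_right t 0))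
    (by simpa using line_mono A x (zero_le_one.trans (le_max_right t 1)))
  obtain ⟨s₁, hs₁⟩ := h (A + P x)
    (by simpa using line_mono A x ((min_le_right t 0).trans zero_le_one))
    (by simpa using line_mono A x (le_max_right t 1))
  have hPy : P y = (s₁ - s₀) • P y' := by
    have : P y = φ (A + P x) - φ A := by rw [hy]; abel
    rw [this, hs₁, hs₀]; module
  have hne : s₁ - s₀ ≠ 0 := fun h0 => by
    rw [h0, zero_smul] at hPy
    rw [hPy, add_zero] at hy
    have := φ.injective hy
    rw [add_eq_left, P_eq_zero] at this
    exact hx this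
  refine ⟨(s - s₀) / (s₁ - s₀), ?_⟩
  rw [hPy, smul_smul, div_mul_cancel₀ _ hne, hs, hs₀]
  module

/-- `φ` maps each line with rank-one direction onto a line with rank-one direction. -/
theorem map_line_onto (A : SAOp H) (x : H) : ∃ y, φ (A + P x) = φ A + P y ∧
    (∀ t : ℝ, ∃ s : ℝ, φ (A + t • P x) = φ A + s • P y) ∧
    ∀ s : ℝ, ∃ t : ℝ, φ (A + t • P x) = φ A + s • P y := by
  obtain ⟨y, hy, h⟩ := map_line φ A x
  obtain ⟨x', hx', h'⟩ := map_line φ.symm (φ A) y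
  rw [← hy, φ.symm_apply_apply, φ.symm_apply_apply, add_right_inj] at hx'
  refine ⟨y, hy, h, fun s => (h' s).imp fun t ht => ?_⟩
  rw [φ.symm_apply_apply, ← hx'] at ht
  rw [← ht, φ.apply_symm_apply]

/-- On vectors orthogonal to `y'` the dominating line has constant form, so the other line cannot
move there in either direction. -/
theorem direction_of_dominated {A B : SAOp H} {y y' : H}
    (h : ∀ s : ℝ, ∃ s' : ℝ, A + s • P y ≤ B + s' • P y') : ∃ c : ℝ, P y = c • P y' := by
  have hz : ∀ z, ⟪y', z⟫_ℂ = 0 → qf (P y) z = 0 := fun z hz => by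
    by_contra h0
    obtain ⟨s', hs'⟩ := h ((qf B z - qf A z + 1) / qf (P y) z)
    have h2 := le_iff.1 hs' z
    simp only [qf_add, qf_smul, qf_P y', hz] at h2
    rw [div_mul_cancel₀ _ h0] at h2
    simp at h2
    linarith
  by_cases hy' : y' = 0
  · exact ⟨0, by rw [zero_smul]; exact ext_qf fun z => by simpa using hz z (by simp [hy'])⟩
  · exact ⟨_, eq_smul_P (P_nonneg y) hy' hz⟩

/-- The image of the direction `P x` under `φ`. -/
noncomputable def dir (x : H) : SAOp H := φ (P x) - φ 0

theorem exists_dir_eq_P (x : H) : ∃ u, dir φ x = P u := by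
  obtain ⟨y, hy, -⟩ := map_segment φ 0 x
  exact ⟨y, by rw [dir, ← zero_add (P x), hy]; abel⟩

theorem map_add_mem_dir (A : SAOp H) (x : H) (t : ℝ) :
    ∃ s : ℝ, φ (A + t • P x) = φ A + s • dir φ x := by
  by_cases hx : x = 0
  · exact ⟨0, by simp [hx]⟩
  -- The lines through `A` and `0` both lie below the parallel line through `D`, so both image
  -- directions are multiples of the one at `D`.
  obtain ⟨D, hAD, h0D⟩ := exists_upper_bound A 0
  obtain ⟨y₀, hy₀, -, h₀⟩ := map_line_onto φ 0 x
  obtain ⟨y, -, hline, h⟩ := map_line_onto φ A x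
  obtain ⟨y', -, h', -⟩ := map_line_onto φ D x
  have key : ∀ {B : SAOp H} {u : H}, B ≤ D →
      (∀ s : ℝ, ∃ t : ℝ, φ (B + t • P x) = φ B + s • P u) → ∃ c : ℝ, P u = c • P y' :=
    fun {B u} hB hu => direction_of_dominated (A := φ B) (B := φ D) fun s => by
      obtain ⟨t, ht⟩ := hu s
      obtain ⟨s', hs'⟩ := h' t
      refine ⟨s', ?_⟩
      rw [← ht, ← hs', φ.le_iff_le]
      exact add_le_add_left hB _
  obtain ⟨c, hc⟩ := key hAD h
  obtain ⟨c₀, hc₀⟩ := key h0D h₀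
  have hdir : dir φ x = P y₀ := by rw [dir, ← zero_add (P x), hy₀]; abel
  have hne : c₀ ≠ 0 := fun h0 => by
    rw [h0, zero_smul] at hc₀
    rw [hc₀, add_zero] at hy₀
    have := φ.injective hy₀
    rw [add_eq_left, P_eq_zero] at this
    exact hx this
  obtain ⟨s, hs⟩ := hline t
  refine ⟨s * c / c₀, ?_⟩
  rw [hs, hdir, hc, hc₀, smul_smul, smul_smul, div_mul_cancel₀ _ hne]

theorem collinear_of_dir_eq {x y : H} {c : ℝ} (h : dir φ x = c • dir φ y) :
    ∃ d : ℂ, x = d • y := by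
  obtain ⟨y₀, hy₀, -, h₀⟩ := map_line_onto φ 0 y
  have hdir : dir φ y = P y₀ := by rw [dir, ← zero_add (P y), hy₀]; abel
  obtain ⟨t, ht⟩ := h₀ c
  rw [← hdir, ← h, dir, add_sub_cancel, zero_add] at ht
  exact exists_eq_smul_of_P_eq (φ.injective ht).symm

/-- The fourth corner of a parallelogram is reached in two ways; independence of the two image
directions forces equal coefficients. -/
theorem increment_add_of_dir_ne {x y : H} (h : ∀ c : ℝ, dir φ x ≠ c • dir φ y) (A : SAOp H)
    (s t : ℝ) :
    φ (A + s • P y + t • P x) - φ (A + s • P y) = φ (A + t • P x) - φ A := by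
  obtain ⟨a, ha⟩ := map_add_mem_dir φ A x t
  obtain ⟨a', ha'⟩ := map_add_mem_dir φ (A + s • P y) x t
  obtain ⟨b, hb⟩ := map_add_mem_dir φ A y s
  obtain ⟨b', hb'⟩ := map_add_mem_dir φ (A + t • P x) y s
  have h1 : (a' - a) • dir φ x = (b' - b) • dir φ y := by
    rw [add_right_comm, ha', hb, ha] at hb'
    linear_combination (norm := module) hb'
  have h2 : a' = a := by
    by_contra hne
    have hne' : a' - a ≠ 0 := sub_ne_zero.2 hne
    refine h ((a' - a)⁻¹ * (b' - b)) ?_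
    rw [mul_smul, ← h1, inv_smul_smul₀ hne']
  rw [ha', ha, h2]; abel

variable (hdim : 1 < Module.rank ℂ H)
include hdim

theorem increment_add_self (A : SAOp H) (x : H) (s t : ℝ) :
    φ (A + s • P x + t • P x) - φ (A + s • P x) = φ (A + t • P x) - φ A := by
  by_cases hx : x = 0
  · simp [hx]
  obtain ⟨y, hy⟩ : ∃ y, ∀ d : ℂ, d • x ≠ y := by
    by_contra! h
    exact absurd (rank_le_one_iff.2 ⟨x, h⟩) hdim.not_ge
  have key : ∀ (a : ℂ) (z : H), z = y + a • x → ∀ c : ℝ, dir φ x ≠ c • dir φ z :=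
    fun a z hz c hc => by
      obtain ⟨d, hd⟩ := collinear_of_dir_eq φ hc
      have hd0 : d ≠ 0 := fun h0 => hx (by rw [hd, h0, zero_smul])
      refine hy (d⁻¹ - a) ?_
      have : d⁻¹ • x = z := by rw [hd, inv_smul_smul₀ hd0]
      rw [sub_smul, this, hz]; abel
  have h1 := fun A s => increment_add_of_dir_ne φ (key 0 y (by simp)) A s t
  have h2 := fun A s => increment_add_of_dir_ne φ (key 1 (x + y) (by simp [add_comm])) A s t
  have h3 := fun A s => increment_add_of_dir_ne φ (x := x) (y := x - y) (fun c hc =>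
    key (-1) (y - x) (by simp [sub_eq_add_neg]) c (by
      rw [hc, dir, dir, ← neg_sub y x, ← neg_one_smul ℂ, P_smul]; simp)) A s t
  -- A move along `P x` is replaced by moves along `P (x + y)`, `P (x - y)` and `P y`, none of which
  -- has image direction parallel to that of `x`.
  have hP : A + s • P x = A + (s / 2) • P (x + y) + (s / 2) • P (x - y) + (-s) • P y := by
    linear_combination (norm := module) (-(s / 2)) • P_add_add_P_sub x y
  rw [hP, h1, h3, h2]

theorem map_add_smul_P (A : SAOp H) (x : H) (t : ℝ) : φ (A + t • P x) = φ A + t • dir φ x := by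
  have lin : ∀ (A : SAOp H) (t : ℝ), φ (A + t • P x) - φ A = t • (φ (A + P x) - φ A) :=
    fun A t => ext_qf fun z => by
      have h := Monotone.eq_mul_of_additive (f := fun t => qf (φ (A + t • P x) - φ A) z)
        (fun s t hst => by
          simp only [qf_sub, sub_le_sub_iff_right]
          exact le_iff.1 (φ.monotone (line_mono A x hst)) z)
        (fun s t => by
          have h1 := increment_add_self φ hdim A x s t
          have h2 := congrArg (qf · z) h1
          rw [add_assoc, ← add_smul] at h2
          simp only [qf_sub] at h2 ⊢
          linarith) t
      simp only [one_smul] at h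
      rw [h, qf_smul]
  -- The forms of `φ (A + t • P x)` and `φ (B + t • P x)` at `z` are affine in `t` and ordered for
  -- every real `t`, so their slopes agree.
  have mono : ∀ {A B : SAOp H}, A ≤ B → φ (A + P x) - φ A = φ (B + P x) - φ B := fun {A B} hAB =>
    ext_qf fun z => by
      by_contra hne
      set a := qf (φ (A + P x) - φ A) z with ha
      set b := qf (φ (B + P x) - φ B) z with hb
      have hne' : a - b ≠ 0 := sub_ne_zero.2 hne
      set t := (qf (φ B) z - qf (φ A) z + 1) / (a - b) with ht
      have h1 := le_iff.1 (φ.monotone (add_le_add_left hAB (t • P x))) z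
      have hA := congrArg (qf · z) (lin A t)
      have hB := congrArg (qf · z) (lin B t)
      simp only [qf_smul, ← ha, ← hb] at hA hB
      rw [qf_sub] at hA hB
      have h2 : t * (a - b) = qf (φ B) z - qf (φ A) z + 1 := div_mul_cancel₀ _ hne'
      linarith
  obtain ⟨D, hAD, h0D⟩ := exists_upper_bound A 0
  have : φ (A + P x) - φ A = dir φ x := by
    rw [mono hAD, ← mono h0D, zero_add, dir]
  rw [← this, ← lin]; abel

end OrderIso

end SAOp

/-! ### Quadratic maps with rank-one values -/

/-- Coefficient comparison for polynomials in `l` and `star l` of bidegree at most `(2, 2)`. -/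
theorem coeffs_eq_zero {V : Type*} [AddCommGroup V] [Module ℂ V]
    {c₂₂ c₁₂ c₂₁ c₂₀ c₀₂ c₁₁ c₁₀ c₀₁ c₀₀ : V}
    (h : ∀ l : ℂ, (l ^ 2 * star l ^ 2) • c₂₂ + (l * star l ^ 2) • c₁₂ + (l ^ 2 * star l) • c₂₁ +
      l ^ 2 • c₂₀ + star l ^ 2 • c₀₂ + (l * star l) • c₁₁ + l • c₁₀ + star l • c₀₁ + c₀₀ = 0) :
    c₁₂ = 0 ∧ c₀₂ = 0 ∧ c₁₁ = 0 ∧ c₀₁ = 0 ∧ c₀₀ = 0 := by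
  have h0 : c₀₀ = 0 := by simpa using h 0
  -- The substitutions `-l` and `2 * l` separate total degrees; the values `1`, `I` and `1 + I` then
  -- separate bidegrees.
  have odd : ∀ l : ℂ, (l * star l ^ 2) • c₁₂ + (l ^ 2 * star l) • c₂₁ + l • c₁₀ + star l • c₀₁ = 0 :=
    fun l => by
      have h1 := h l
      have h2 := h (-l)
      rw [star_neg] at h2
      linear_combination (norm := module) (1 / 2 : ℂ) • h1 - (1 / 2 : ℂ) • h2
  have even : ∀ l : ℂ, (l ^ 2 * star l ^ 2) • c₂₂ + l ^ 2 • c₂₀ + star l ^ 2 • c₀₂ +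
      (l * star l) • c₁₁ = 0 := fun l => by
    have h1 := h l
    have h2 := h (-l)
    rw [star_neg] at h2
    linear_combination (norm := module) (1 / 2 : ℂ) • h1 + (1 / 2 : ℂ) • h2 - h0
  have scale : ∀ l : ℂ, star ((2 : ℂ) * l) = 2 * star l := fun l => by simp
  have odd3 : ∀ l : ℂ, (l * star l ^ 2) • c₁₂ + (l ^ 2 * star l) • c₂₁ = 0 := fun l => by
    have h1 := odd l
    have h2 := odd (2 * l)
    rw [scale] at h2
    linear_combination (norm := module) (1 / 6 : ℂ) • h2 - (1 / 3 : ℂ) • h1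
  have even2 : ∀ l : ℂ, l ^ 2 • c₂₀ + star l ^ 2 • c₀₂ + (l * star l) • c₁₁ = 0 := fun l => by
    have h1 := even l
    have h2 := even (2 * l)
    rw [scale] at h2
    linear_combination (norm := module) (4 / 3 : ℂ) • h1 - (1 / 12 : ℂ) • h2
  have a1 : c₁₂ + c₂₁ = 0 := by simpa using odd3 1
  have aI : c₂₁ - c₁₂ = 0 := by
    have h2 : (-Complex.I) • c₁₂ + Complex.I • c₂₁ = 0 := by
      simpa [pow_two, ← mul_assoc] using odd3 Complex.I
    have h3 : Complex.I • (c₂₁ - c₁₂) = 0 := by linear_combination (norm := module) h2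
    exact (smul_eq_zero.1 h3).resolve_left Complex.I_ne_zero
  have h12 : c₁₂ = 0 := by
    linear_combination (norm := module) (1 / 2 : ℂ) • a1 - (1 / 2 : ℂ) • aI
  have h01 : c₀₁ = 0 := by
    have h21 : c₂₁ = 0 := by linear_combination (norm := module) a1 - h12
    have b1 : c₁₀ + c₀₁ = 0 := by simpa [h12, h21] using odd 1
    have bI : Complex.I • (c₁₀ - c₀₁) = 0 := by
      have := odd Complex.I
      simp only [h12, h21, smul_zero, zero_add, Complex.star_def, Complex.conj_I] at this
      linear_combination (norm := module) this
    have bI' := (smul_eq_zero.1 bI).resolve_left Complex.I_ne_zero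
    linear_combination (norm := module) (1 / 2 : ℂ) • b1 - (1 / 2 : ℂ) • bI'
  have d1 : c₂₀ + c₀₂ + c₁₁ = 0 := by simpa using even2 1
  have dI : -c₂₀ - c₀₂ + c₁₁ = 0 := by
    simpa [← sub_eq_add_neg] using even2 Complex.I
  have h11 : c₁₁ = 0 := by
    linear_combination (norm := module) (1 / 2 : ℂ) • d1 + (1 / 2 : ℂ) • dI
  have d2 : Complex.I • (c₂₀ - c₀₂) = 0 := by
    have := even2 (1 + Complex.I)
    have e1 : (1 + Complex.I) ^ 2 = 2 * Complex.I := by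
      linear_combination Complex.I_sq
    have e2 : star (1 + Complex.I) ^ 2 = -2 * Complex.I := by
      rw [← star_pow, e1]; simp
    rw [e1, e2, h11] at this
    linear_combination (norm := module) (1 / 2 : ℂ) • this
  have d2' := (smul_eq_zero.1 d2).resolve_left Complex.I_ne_zero
  refine ⟨h12, ?_, h11, h01, h0⟩
  linear_combination (norm := module) (1 / 2 : ℂ) • d1 - (1 / 2 : ℂ) • d2' - (1 / 2 : ℂ) • h11

namespace InnerProductSpace

variable {H : Type*} [NormedAddCommGroup H] [InnerProductSpace ℂ H]

local notation "R" => rankOne ℂ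

/-- This removes the unknown `u`, turning the rank-one condition into an identity that is polynomial
in `l` and `star l` along a pencil. -/
theorem rankOne_apply_self {N : H →L[ℂ] H} (h : ∃ u, N = R u u) (f : H) :
    R (N f) (N f) = ⟪f, N f⟫_ℂ • N := by
  obtain ⟨u, rfl⟩ := h
  ext z
  simp [smul_smul]

theorem pencil_coeffs {F K K' : H →L[ℂ] H} {f : H} (hf : ‖f‖ = 1)
    (h : ∀ l : ℂ, ∃ u, F + star l • K + l • K' + (l * star l) • R f f = R u u) :
    R (K f) f + R f (K' f) = K + ⟪f, K f⟫_ℂ • R f f ∧ R (K f) (K' f) = ⟪f, K f⟫_ℂ • K ∧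
    R (K f) (K f) + R (K' f) (K' f) + R (F f) f + R f (F f) =
      F + ⟪f, K f⟫_ℂ • K' + ⟪f, K' f⟫_ℂ • K + ⟪f, F f⟫_ℂ • R f f ∧
    R (K f) (F f) + R (F f) (K' f) = ⟪f, K f⟫_ℂ • F + ⟪f, F f⟫_ℂ • K ∧
    R (F f) (F f) = ⟪f, F f⟫_ℂ • F := by
  have hff : ⟪f, f⟫_ℂ = 1 := by rw [inner_self_eq_norm_sq_to_K, hf]; simp
  set k := ⟪f, K f⟫_ℂ with hk
  set k' := ⟪f, K' f⟫_ℂ with hk'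
  set p := ⟪f, F f⟫_ℂ with hp
  have := coeffs_eq_zero (c₂₂ := (0 : H →L[ℂ] H))
    (c₁₂ := R (K f) f + R f (K' f) - (K + k • R f f))
    (c₂₁ := R (K' f) f + R f (K f) - (K' + k' • R f f))
    (c₂₀ := R (K' f) (K f) - k' • K')
    (c₀₂ := R (K f) (K' f) - k • K)
    (c₁₁ := R (K f) (K f) + R (K' f) (K' f) + R (F f) f + R f (F f) -
      (F + k • K' + k' • K + p • R f f))
    (c₁₀ := R (K' f) (F f) + R (F f) (K f) - (k' • F + p • K'))
    (c₀₁ := R (K f) (F f) + R (F f) (K' f) - (k • F + p • K))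
    (c₀₀ := R (F f) (F f) - p • F) fun l => by
      have h1 := rankOne_apply_self (h l) f
      have h2 : (F + star l • K + l • K' + (l * star l) • R f f) f =
          F f + star l • K f + l • K' f + (l * star l) • f := by
        simp only [add_apply, smul_apply, rankOne_apply, hff, one_smul]
      rw [h2] at h1
      simp only [map_add, map_smul, map_smulₛₗ, inner_add_right, inner_smul_right,
        add_apply, smul_apply, hff, ← hk, ← hk', ← hp, map_mul, RCLike.star_def,
        Complex.conj_conj] at h1 ⊢
      linear_combination (norm := module) h1
  simpa only [sub_eq_zero] using this

theorem pencil_split {F K K' : H →L[ℂ] H} {f : H} (hf : ‖f‖ = 1)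
    (h : ∀ l : ℂ, ∃ u, F + star l • K + l • K' + (l * star l) • R f f = R u u) :
    K = R (K f) f ∨ K = R f (K' f) := by
  obtain ⟨h1, h2, -⟩ := pencil_coeffs hf h
  have hff : ⟪f, f⟫_ℂ = 1 := by rw [inner_self_eq_norm_sq_to_K, hf]; simp
  set k := ⟪f, K f⟫_ℂ with hk
  -- Two coefficient relations combine into a vanishing rank-one product; each factor gives one
  -- alternative.
  have h3 : R (K f - k • f) (K' f - star k • f) = 0 := by
    simp only [map_sub, map_smul, map_smulₛₗ, sub_apply, smul_apply, h2,
      RCLike.star_def, Complex.conj_conj]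
    linear_combination (norm := module) -k • h1
  rcases rankOne_eq_zero.1 h3 with h4 | h4
  · right
    rw [sub_eq_zero.1 h4] at h1
    simp only [map_smul, smul_apply] at h1
    linear_combination (norm := module) -h1
  · left
    rw [sub_eq_zero.1 h4] at h1
    simp only [map_smulₛₗ, RCLike.star_def, Complex.conj_conj] at h1
    linear_combination (norm := module) -h1

theorem pencil_const {F : H →L[ℂ] H} {f v : H} (hf : ‖f‖ = 1) (hfv : ⟪f, v⟫_ℂ = 0)
    (h : ∀ l : ℂ, ∃ u, F + star l • R v f + l • R f v + (l * star l) • R f f = R u u) :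
    F = R v v ∨ ∃ c : ℝ, F = (c : ℂ) • R f f := by
  obtain ⟨-, -, h11, h01, h00⟩ := pencil_coeffs hf h
  have hff : ⟪f, f⟫_ℂ = 1 := by rw [inner_self_eq_norm_sq_to_K, hf]; simp
  have hvf : ⟪v, f⟫_ℂ = 0 := by rw [← inner_conj_symm, hfv, map_zero]
  obtain ⟨t, ht⟩ : ∃ t, F = R t t := by simpa using h 0
  simp only [rankOne_apply, hff, hvf, one_smul, zero_smul, hfv, map_zero, inner_zero_right, add_zero] at h11 h01
  obtain ⟨p, hp⟩ : ∃ p : ℝ, ⟪f, F f⟫_ℂ = p := ⟨‖⟪t, f⟫_ℂ‖ ^ 2, by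
    rw [ht, rankOne_apply, inner_smul_right, ← inner_conj_symm f t, Complex.mul_conj,
      Complex.normSq_eq_norm_sq]⟩
  rw [hp] at h11 h01 h00
  -- If `p = 0` then `F f = 0` and the `l * star l` coefficient reads `F = R v v`; otherwise `f`
  -- turns out to be an eigenvector, which gives the exceptional multiple of `R f f`.
  by_cases hp0 : p = 0
  · left
    rw [hp0] at h00 h11
    have hFf : F f = 0 := by
      rw [Complex.ofReal_zero, zero_smul] at h00
      simpa using h00
    simp only [hFf, map_zero, zero_apply, Complex.ofReal_zero, zero_smul, add_zero] at h11
    exact h11.symm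
  right
  have hp0' : (p : ℂ) ≠ 0 := by exact_mod_cast hp0
  refine ⟨p, ?_⟩
  suffices hFf : F f = (p : ℂ) • f by
    rw [hFf] at h00
    simp only [map_smul, map_smulₛₗ, smul_apply, Complex.conj_ofReal] at h00
    have := congrArg ((p : ℂ)⁻¹ • ·) h00
    simpa only [inv_smul_smul₀ hp0'] using this.symm
  have h3 : R v (F f - (p : ℂ) • f) = 0 := by
    simp only [map_sub, map_smulₛₗ, Complex.conj_ofReal]
    linear_combination (norm := module) h01
  rcases rankOne_eq_zero.1 h3 with hv | h4
  · simp only [hv, map_zero, zero_add] at h11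
    have h5 : R (F f - (p : ℂ) • f) (F f - (p : ℂ) • f) = 0 := by
      simp only [map_sub, map_smul, map_smulₛₗ, sub_apply, smul_apply, Complex.conj_ofReal]
      linear_combination (norm := module) h00 - (p : ℂ) • h11
    exact sub_eq_zero.1 ((rankOne_eq_zero.1 h5).elim id id)
  · exact sub_eq_zero.1 h4

/-- A quadratic family of rank-one operators whose increments along `e` are governed by `T` is
`x ↦ (T x) ⊗ (T x)`. -/
theorem eq_rankOne_of_increments {Φ : H → H →L[ℂ] H} {T : H → H} {e f : H} (hf : ‖f‖ = 1)
    (h0 : Φ 0 = 0) (hT0 : T 0 = 0) (hP : ∀ x, ∃ u, Φ x = R u u)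
    (hinc : ∀ x (l : ℂ), ∃ m : ℂ, T (x + m • e) = T x + l • f ∧
      Φ (x + m • e) = Φ x + star l • R (T x) f + l • R f (T x) + (l * star l) • R f f)
    (hcol : ∀ x (c : ℝ), Φ x = (c : ℂ) • R f f → ∃ d : ℂ, x = d • e)
    (hTe : ∀ d : ℂ, ⟪f, T (d • e)⟫_ℂ = 0 → d = 0) (x : H) : Φ x = R (T x) (T x) := by
  have hff : ⟪f, f⟫_ℂ = 1 := by rw [inner_self_eq_norm_sq_to_K, hf]; simp
  set k := ⟪f, T x⟫_ℂ with hk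
  -- Moving along `e` until `T` becomes orthogonal to `f` allows `pencil_const`; the increment
  -- formula then leads back to `x`.
  obtain ⟨m, hm1, hm2⟩ := hinc x (-k)
  have hperp : ⟪f, T (x + m • e)⟫_ℂ = 0 := by
    rw [hm1, inner_add_right, inner_smul_right, hff, ← hk]; ring
  have hx' : Φ (x + m • e) = R (T (x + m • e)) (T (x + m • e)) := by
    rcases pencil_const (F := Φ (x + m • e)) hf hperp fun l => by
      obtain ⟨m', -, hm'⟩ := hinc (x + m • e) l
      rw [← hm']; exact hP _ with h | ⟨c, hc⟩
    · exact h
    · obtain ⟨d, hd⟩ := hcol _ c hc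
      rw [hd] at hperp ⊢
      rw [hTe d hperp]; simp [h0, hT0]
  rw [hm2, hm1] at hx'
  simp only [map_add, map_smul, map_smulₛₗ, add_apply, smul_apply, star_neg, neg_smul, neg_mul,
    mul_neg, neg_neg, map_neg, neg_apply, RCLike.star_def] at hx'
  linear_combination (norm := module) hx'

variable [CompleteSpace H]

theorem exists_linear_or_conjLinear {Φ : H → H →L[ℂ] H} (hH : Nontrivial H)
    (hP : ∀ x, ∃ u, Φ x = R u u)
    (hadd : ∀ x y z, Φ (x + y + z) + Φ x + Φ y + Φ z = Φ (x + y) + Φ (x + z) + Φ (y + z))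
    (hreal : ∀ (t : ℝ) x y, Φ ((t : ℂ) • x + y) + (t : ℂ) • Φ x + (t : ℂ) • Φ y =
      (t : ℂ) • Φ (x + y) + (t : ℂ) ^ 2 • Φ x + Φ y)
    (hsmul : ∀ (c : ℂ) x, Φ (c • x) = (c * star c) • Φ x)
    (hcol : ∀ x y (c : ℝ), Φ x = (c : ℂ) • Φ y → ∃ d : ℂ, x = d • y) :
    (∃ T : H →ₗ[ℂ] H, ∀ x, Φ x = R (T x) (T x)) ∨
    (∃ T : H →ₗ⋆[ℂ] H, ∀ x, Φ x = R (T x) (T x)) := by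
  have h0 : Φ 0 = 0 := by simpa using hsmul 0 0
  obtain ⟨e, f, hf, he⟩ : ∃ e f : H, ‖f‖ = 1 ∧ Φ e = R f f := by
    obtain ⟨e, he⟩ := exists_ne (0 : H)
    obtain ⟨u, hu⟩ := hP e
    have hu0 : u ≠ 0 := fun h => by
      obtain ⟨d, hd⟩ := hcol e 0 0 (by simp [hu, h])
      exact he (by simpa using hd)
    refine ⟨((‖u‖⁻¹ : ℝ) : ℂ) • e, ((‖u‖⁻¹ : ℝ) : ℂ) • u, ?_, ?_⟩
    · rw [norm_smul]; simp [hu0]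
    · rw [hsmul, hu]
      simp only [map_smul, map_smulₛₗ, smul_apply, smul_smul, RCLike.star_def, mul_comm]
  have hff : ⟪f, f⟫_ℂ = 1 := by rw [inner_self_eq_norm_sq_to_K, hf]; simp
  set M : H → H →L[ℂ] H := fun x => Φ (x + e) - Φ x - Φ e with hM
  have Madd : ∀ x y, M (x + y) = M x + M y := fun x y => by
    simp only [hM]; linear_combination (norm := module) hadd x y e
  have Mreal : ∀ (t : ℝ) x, M ((t : ℂ) • x) = (t : ℂ) • M x := fun t x => by
    have h1 := hreal t x e
    have h2 := hsmul t x
    rw [RCLike.star_def, Complex.conj_ofReal] at h2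
    simp only [hM]
    linear_combination (norm := module) h1 - h2
  have Madj : ∀ x, ContinuousLinearMap.adjoint (M x) = M x := fun x => by
    have : ∀ x, ContinuousLinearMap.adjoint (Φ x) = Φ x := fun x => by
      obtain ⟨u, hu⟩ := hP x; rw [hu]; simp
    simp only [hM, map_sub, this]
  -- `K` and `K'` are the complex-linear and conjugate-linear parts of the real-linear polarization
  -- `M`.
  set K : H → H →L[ℂ] H := fun x => (1 / 2 : ℂ) • (M x - Complex.I • M (Complex.I • x)) with hK
  set K' : H → H →L[ℂ] H := fun x => (1 / 2 : ℂ) • (M x + Complex.I • M (Complex.I • x)) with hK'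
  have Kadd : ∀ x y, K (x + y) = K x + K y := fun x y => by
    simp only [hK, smul_add, Madd]; module
  have Kadj : ∀ x, ContinuousLinearMap.adjoint (K x) = K' x := fun x => by
    simp only [hK, hK', map_smulₛₗ, map_sub, Madj, Complex.conj_I]
    simp [Complex.conj_ofNat]
  have KI : ∀ x, K (Complex.I • x) = Complex.I • K x := fun x => by
    have h1 : M (Complex.I • Complex.I • x) = - M x := by
      have := Mreal (-1) x
      rw [smul_smul, Complex.I_mul_I]
      simpa using this
    simp only [hK, h1]
    have h2 : Complex.I • Complex.I • M (Complex.I • x) = -M (Complex.I • x) := by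
      rw [smul_smul, Complex.I_mul_I]; simp
    linear_combination (norm := module) (1 / 2 : ℂ) • h2
  have Ksmul : ∀ (c : ℂ) x, K (c • x) = c • K x := fun c x => by
    have hr : ∀ (t : ℝ) x, K ((t : ℂ) • x) = (t : ℂ) • K x := fun t x => by
      simp only [hK]
      rw [smul_comm Complex.I, Mreal, Mreal]
      module
    conv_lhs => rw [← Complex.re_add_im c]
    conv_rhs => rw [← Complex.re_add_im c]
    rw [add_smul, mul_smul, Kadd, hr, hr, KI]
    module
  have K'add : ∀ x y, K' (x + y) = K' x + K' y := fun x y => by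
    simp only [← Kadj, Kadd, map_add]
  have K'smul : ∀ (c : ℂ) x, K' (c • x) = star c • K' x := fun c x => by
    simp only [← Kadj, Ksmul, map_smulₛₗ, RCLike.star_def]
  have KM : ∀ x, K x + K' x = M x := fun x => by simp only [hK, hK']; module
  have expand : ∀ x (l : ℂ), Φ (x + l • e) =
      Φ x + star l • K x + l • K' x + (l * star l) • R f f := fun x l => by
    by_cases hl : l = 0
    · simp [hl]
    have hl' : star l ≠ 0 := by simpa using hl
    have h1 : x + l • e = l • (l⁻¹ • x + e) := by rw [smul_add, smul_inv_smul₀ hl]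
    have h2 : Φ (l⁻¹ • x + e) = M (l⁻¹ • x) + Φ (l⁻¹ • x) + Φ e := by simp only [hM]; abel
    rw [h1, hsmul, h2, ← KM, Ksmul, K'smul, hsmul, he, star_inv₀]
    simp only [smul_add, smul_smul]
    congr 1
    field_simp
    simp only [one_smul]
    abel
  have Ke : K e = R f f ∧ K' e = R f f := by
    have h1 : M e = (2 : ℂ) • R f f := by
      have : e + e = (2 : ℂ) • e := by module
      simp only [hM, this, hsmul, he]
      simp only [RCLike.star_def, Complex.conj_ofNat]
      module
    have h2 : M (Complex.I • e) = 0 := by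
      have h3 : Complex.I • e + e = (Complex.I + 1) • e := by module
      simp only [hM, h3, hsmul, he]
      have h4 : (Complex.I + 1) * star (Complex.I + 1) = 2 := by
        simp only [star_add, RCLike.star_def, Complex.conj_I, star_one]
        linear_combination -Complex.I_sq
      rw [h4]
      simp only [RCLike.star_def, Complex.conj_I, mul_neg, Complex.I_mul_I]
      module
    simp only [hK, hK', h1, h2]
    constructor <;> module
  have split : ∀ x, K x = R (K x f) f ∨ K x = R f (K' x f) := fun x =>
    pencil_split (F := Φ x) hf fun l => by rw [← expand]; exact hP _
  -- Both alternatives define additive subgroups, and a group is not the union of two proper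
  -- subgroups.
  have uniform : (∀ x, K x = R (K x f) f) ∨ (∀ x, K x = R f (K' x f)) := by
    by_contra! hcon
    obtain ⟨⟨x, hx⟩, ⟨y, hy⟩⟩ := hcon
    have hx' := (split x).resolve_left hx
    have hy' := (split y).resolve_right hy
    rcases split (x + y) with h | h
    · apply hx
      simp only [Kadd, map_add, add_apply] at h
      linear_combination (norm := module) h - hy'
    · apply hy
      simp only [Kadd, K'add, map_add, add_apply] at h
      linear_combination (norm := module) h - hx'
  have hcol' : ∀ x (c : ℝ), Φ x = (c : ℂ) • R f f → ∃ d : ℂ, x = d • e := fun x c h =>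
    hcol x e c (by rw [h, he])
  rcases uniform with hu | hu
  · left
    let T : H →ₗ[ℂ] H :=
      { toFun := fun x => K x f
        map_add' := fun x y => by rw [Kadd, add_apply]
        map_smul' := fun c x => by rw [Ksmul, smul_apply, RingHom.id_apply] }
    have hTe : T e = f := by
      change K e f = f
      rw [Ke.1, rankOne_apply, hff, one_smul]
    have hK1 : ∀ x, K x = R (T x) f := hu
    have hK2 : ∀ x, K' x = R f (T x) := fun x => by rw [← Kadj, hK1]; simp
    refine ⟨T, eq_rankOne_of_increments (e := e) hf h0 (map_zero T) hP (fun x l => ⟨l, ?_, ?_⟩)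
      hcol' fun d hd => ?_⟩
    · rw [map_add, map_smul, hTe]
    · rw [expand, hK1, hK2]
    · rwa [map_smul, hTe, inner_smul_right, hff, mul_one] at hd
  · right
    let T : H →ₗ⋆[ℂ] H :=
      { toFun := fun x => K' x f
        map_add' := fun x y => by rw [K'add, add_apply]
        map_smul' := fun c x => by rw [K'smul, smul_apply, RCLike.star_def] }
    have hTe : T e = f := by
      change K' e f = f
      rw [Ke.2, rankOne_apply, hff, one_smul]
    have hK1 : ∀ x, K x = R f (T x) := hu
    have hK2 : ∀ x, K' x = R (T x) f := fun x => by rw [← Kadj, hK1]; simp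
    refine ⟨T, eq_rankOne_of_increments (e := e) hf h0 (map_zero T) hP
      (fun x l => ⟨star l, ?_, ?_⟩) hcol' fun d hd => ?_⟩
    · rw [map_add, map_smulₛₗ, hTe, RCLike.star_def, Complex.conj_conj]
    · rw [expand, hK1, hK2, star_star]
      module
    · rw [map_smulₛₗ, hTe, inner_smul_right, hff, mul_one] at hd
      simpa using hd

end InnerProductSpace

/-! ### From rank-one directions to all operators -/

namespace SAOp

variable {H : Type*} [NormedAddCommGroup H] [InnerProductSpace ℂ H] [CompleteSpace H]

section OrderIso

variable (φ : SAOp H ≃o SAOp H)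

theorem exists_dir_preimage (y : H) : ∃ x, dir φ x = P y := by
  obtain ⟨x, hx, -⟩ := map_segment φ.symm (φ 0) y
  refine ⟨x, ?_⟩
  rw [φ.symm_apply_apply, zero_add, φ.symm_apply_eq] at hx
  rw [dir, ← hx, add_sub_cancel_left]

variable (hdim : 1 < Module.rank ℂ H)
include hdim

/-- Applying `φ` to `(‖x‖ ^ 2)⁻¹ • P x ≤ one` bounds `dir φ x`; testing at `y` yields the bound that
makes `T` continuous. -/
theorem norm_le_of_dir_eq {x y : H} (h : dir φ x = P y) :
    ‖y‖ ≤ Real.sqrt ‖op (φ one - φ 0)‖ * ‖x‖ := by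
  have hle : dir φ x ≤ (‖x‖ ^ 2) • (φ one - φ 0) := by
    by_cases hx : x = 0
    · simp [hx, dir]
    have hx' : 0 < ‖x‖ ^ 2 := by positivity
    have h1 : (‖x‖ ^ 2)⁻¹ • P x ≤ (one : SAOp H) := le_iff.2 fun z => by
      rw [qf_smul, qf_P, qf_one, inv_mul_le_iff₀ hx', ← mul_pow]
      gcongr
      exact norm_inner_le_norm _ _
    have h2 := φ.monotone h1
    rw [← zero_add ((‖x‖ ^ 2)⁻¹ • P x), map_add_smul_P φ hdim] at h2
    refine le_iff.2 fun z => ?_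
    have h3 := le_iff.1 h2 z
    simp only [qf_add, qf_smul, qf_sub] at h3 ⊢
    rw [← inv_mul_le_iff₀ hx']
    linarith
  by_cases hy : y = 0
  · rw [hy, norm_zero]; positivity
  have h1 := le_iff.1 hle y
  rw [h, qf_P, qf_smul, inner_self_eq_norm_sq_to_K] at h1
  have h2 := qf_le_norm (φ one - φ 0) y
  have hy' : 0 < ‖y‖ ^ 2 := by positivity
  have h3 : ‖y‖ ^ 2 * ‖y‖ ^ 2 ≤ (‖op (φ one - φ 0)‖ * ‖x‖ ^ 2) * ‖y‖ ^ 2 := by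
    calc ‖y‖ ^ 2 * ‖y‖ ^ 2 ≤ ‖x‖ ^ 2 * qf (φ one - φ 0) y := by
          simpa [← pow_add, ← pow_mul] using h1
      _ ≤ ‖x‖ ^ 2 * (‖op (φ one - φ 0)‖ * ‖y‖ ^ 2) := by gcongr
      _ = _ := by ring
  have h4 := le_of_mul_le_mul_right h3 hy'
  rw [← Real.sqrt_sq (norm_nonneg x), ← Real.sqrt_mul (norm_nonneg _)]
  exact Real.le_sqrt_of_sq_le h4

variable {T T' : H → H} (hsurj : Function.Surjective T)
  (hT : ∀ x z, ‖⟪T x, z⟫_ℂ‖ = ‖⟪x, T' z⟫_ℂ‖) (hdir : ∀ x, dir φ x = P (T x))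
include hsurj hT hdir

/-- Rank-one minorants from `smul_P_apply_le` attain the form at the chosen vector. Pushing one
forward from `C` and pulling one back from `φ (B + C) - φ B` gives the two inequalities. Only moduli
of inner products enter, so linear and conjugate-linear `T` are covered together. -/
theorem qf_increment {C : SAOp H} (hC : 0 ≤ C) (B : SAOp H) (z : H) :
    qf (φ (B + C) - φ B) z = qf C (T' z) := by
  have hD : 0 ≤ φ (B + C) - φ B := sub_nonneg.2 (φ.monotone (le_add_of_nonneg_right hC))
  apply le_antisymm
  · rcases (nonneg_iff.1 hD z).eq_or_lt with h0 | hpos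
    · rw [← h0]; exact nonneg_iff.1 hC _
    set D := φ (B + C) - φ B with hDdef
    obtain ⟨x, hx⟩ := hsurj (op D z)
    have h1 := smul_P_apply_le hD hpos
    rw [← hx, ← hdir, hDdef, le_sub_iff_add_le', ← hDdef, ← map_add_smul_P φ hdim, φ.le_iff_le,
      add_le_add_iff_left] at h1
    have h2 := le_iff.1 h1 (T' z)
    rw [qf_smul, qf_P, ← hT, hx, inner_symm, inner_self_eq_qf, Complex.norm_real, Real.norm_eq_abs,
      sq_abs, pow_two, inv_mul_cancel_left₀ hpos.ne'] at h2
    exact h2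
  · rcases (nonneg_iff.1 hC (T' z)).eq_or_lt with h0 | hpos
    · rw [← h0]; exact nonneg_iff.1 hD _
    have h1 := φ.monotone (add_le_add_right (smul_P_apply_le hC hpos) B)
    rw [map_add_smul_P φ hdim, hdir] at h1
    have h2 := le_iff.1 h1 z
    rw [qf_add, qf_smul, qf_P, hT, inner_symm, inner_self_eq_qf, Complex.norm_real,
      Real.norm_eq_abs, sq_abs, pow_two, inv_mul_cancel_left₀ hpos.ne'] at h2
    rw [qf_sub]; linarith

theorem qf_map_sub (A : SAOp H) (z : H) : qf (φ A - φ 0) z = qf A (T' z) := by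
  -- With base point `-D`, both `A` and `0` are reached by positive increments.
  obtain ⟨D, hD, h0⟩ := exists_upper_bound (-A) 0
  have h1 := qf_increment φ hdim hsurj hT hdir (C := A + D) (by
    simpa [add_comm] using neg_le_iff_add_nonneg.1 hD) (-D) z
  have h2 := qf_increment φ hdim hsurj hT hdir h0 (-D) z
  rw [show -D + (A + D) = A by abel] at h1
  rw [neg_add_cancel] at h2
  simp only [qf_sub, qf_add] at h1 h2 ⊢
  linarith

end OrderIso

theorem op_eq_of_qf_eq {D : SAOp H} {S : H →L[ℂ] H} (h : ∀ z, ⟪z, S z⟫_ℂ = qf D z) :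
    op D = S := by
  have := (ext_inner_map (op D : H →ₗ[ℂ] H) (S : H →ₗ[ℂ] H)).1 fun z => by
    rw [← inner_conj_symm]
    conv_rhs => rw [← inner_conj_symm]
    exact congrArg _ ((inner_self_eq_qf D z).trans (h z).symm)
  exact ContinuousLinearMap.coe_injective this

open InnerProductSpace in
theorem dir_linear_or_conjLinear (φ : SAOp H ≃o SAOp H) (hdim : 1 < Module.rank ℂ H) :
    (∃ T : H →ₗ[ℂ] H, ∀ x, dir φ x = P (T x)) ∨ (∃ T : H →ₗ⋆[ℂ] H, ∀ x, dir φ x = P (T x)) := by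
  have hop : Function.Injective (op : SAOp H → H →L[ℂ] H) := Subtype.val_injective
  have hH : Nontrivial H := by
    by_contra h
    rw [not_nontrivial_iff_subsingleton] at h
    rw [rank_subsingleton'] at hdim
    exact absurd hdim (by simp)
  have hmap := map_add_smul_P φ hdim
  have hmap1 : ∀ A x, φ (A + P x) = φ A + dir φ x := fun A x => by
    simpa using hmap A x 1
  have hmap0 : ∀ x (t : ℝ), φ (t • P x) = φ 0 + t • dir φ x := fun x t => by
    simpa using hmap 0 x t
  have hmap10 : ∀ x, φ (P x) = φ 0 + dir φ x := fun x => by simpa using hmap 0 x 1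
  have hdd : ∀ x y z, dir φ (x + y + z) + dir φ x + dir φ y + dir φ z =
      dir φ (x + y) + dir φ (x + z) + dir φ (y + z) := fun x y z => by
    have h : P (x + y + z) + P x + P y + P z = P (x + y) + P (x + z) + P (y + z) :=
      hop (by
        change rankOne ℂ _ _ + rankOne ℂ _ _ + rankOne ℂ _ _ + rankOne ℂ _ _ =
          rankOne ℂ _ _ + rankOne ℂ _ _ + rankOne ℂ _ _
        simp only [map_add, add_apply]; abel)
    have h2 := congrArg φ h
    simp only [hmap1, hmap10] at h2
    linear_combination (norm := module) h2
  have hdr : ∀ (t : ℝ) x y, dir φ ((t : ℂ) • x + y) + t • dir φ x + t • dir φ y =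
      t • dir φ (x + y) + t ^ 2 • dir φ x + dir φ y := fun t x y => by
    have h : P ((t : ℂ) • x + y) + t • P x + t • P y = P y + t • P (x + y) + t ^ 2 • P x :=
      hop (by
        simp only [op_add, op_smul]
        change rankOne ℂ _ _ + _ • rankOne ℂ _ _ + _ • rankOne ℂ _ _ =
          rankOne ℂ _ _ + _ • rankOne ℂ _ _ + _ • rankOne ℂ _ _
        simp only [map_add, map_smul, map_smulₛₗ, add_apply, smul_apply, Complex.conj_ofReal,
          Complex.ofReal_pow]
        module)
    have h2 := congrArg φ h
    simp only [hmap, hmap10] at h2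
    linear_combination (norm := module) h2
  have hds : ∀ (c : ℂ) x, dir φ (c • x) = (‖c‖ ^ 2) • dir φ x := fun c x => by
    conv_lhs => rw [dir, P_smul, hmap0, add_sub_cancel_left]
  have main := exists_linear_or_conjLinear (Φ := fun x => op (dir φ x)) hH
    (fun x => (exists_dir_eq_P φ x).imp fun u hu => by rw [hu]; rfl)
    (fun x y z => by simpa only [op_add] using congrArg op (hdd x y z))
    (fun t x y => by
      simpa only [op_add, op_smul, Complex.ofReal_pow] using congrArg op (hdr t x y))
    (fun c x => by
      rw [hds, op_smul, RCLike.star_def, Complex.mul_conj, Complex.normSq_eq_norm_sq])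
    (fun x y c h => collinear_of_dir_eq φ (c := c) (hop (by rw [h, op_smul])))
  exact main.imp (fun ⟨T, hT⟩ => ⟨T, fun x => hop (hT x)⟩) fun ⟨T, hT⟩ => ⟨T, fun x => hop (hT x)⟩

/-- `P y` determines `y` only up to a scalar; surjectivity of `σ` lets that scalar be absorbed into
the argument of `T`. -/
theorem bijective_of_dir_eq (φ : SAOp H ≃o SAOp H) {σ : ℂ →+* ℂ} [RingHomSurjective σ]
    {T : H →ₛₗ[σ] H} (hT : ∀ x, dir φ x = P (T x)) : Function.Bijective T := by
  refine ⟨(injective_iff_map_eq_zero T).2 fun x hx => ?_, fun y => ?_⟩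
  · obtain ⟨d, hd⟩ := collinear_of_dir_eq φ (x := x) (y := 0) (c := 0) (by simp [hT, hx])
    simpa using hd
  · obtain ⟨x, hx⟩ := exists_dir_preimage φ y
    rw [hT] at hx
    obtain ⟨d, hd⟩ := exists_eq_smul_of_P_eq (x := y) (y := T x) (c := 1)
      (by rw [one_smul, hx])
    obtain ⟨c, rfl⟩ := RingHomSurjective.is_surjective (σ := σ) d
    exact ⟨c • x, by rw [map_smulₛₗ, ← hd]⟩

end SAOp

open SAOp in
theorem theorem2 {H : Type*} [NormedAddCommGroup H] [InnerProductSpace ℂ H] [CompleteSpace H]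
    (hdim : 1 < Module.rank ℂ H)
    (φ : selfAdjoint (H →L[ℂ] H) → selfAdjoint (H →L[ℂ] H))
    (hbij : Function.Bijective φ)
    (hord : ∀ A B : selfAdjoint (H →L[ℂ] H), A ≤ B ↔ φ A ≤ φ B) :
    ∃ X : selfAdjoint (H →L[ℂ] H),
      (∃ T : H ≃L[ℂ] H, ∀ A : selfAdjoint (H →L[ℂ] H),
        (φ A : H →L[ℂ] H) =
          (T : H →L[ℂ] H).comp
            ((A : H →L[ℂ] H).comp (ContinuousLinearMap.adjoint (T : H →L[ℂ] H))) + X) ∨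
      (∃ T : H ≃L⋆[ℂ] H, ∀ A : selfAdjoint (H →L[ℂ] H),
        (φ A : H →L[ℂ] H) =
          (T : H →L⋆[ℂ] H).comp
            ((A : H →L[ℂ] H).comp (conjAdjoint (T : H →L⋆[ℂ] H))) + X) := by
  let ψ : SAOp H ≃o SAOp H :=
    { toEquiv := Equiv.ofBijective φ hbij
      map_rel_iff' := fun {A B} => (hord A B).symm }
  refine ⟨φ 0, ?_⟩
  rcases dir_linear_or_conjLinear ψ hdim with ⟨T₀, hT₀⟩ | ⟨T₀, hT₀⟩
  · left
    have hbT := bijective_of_dir_eq ψ hT₀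
    let T : H ≃L[ℂ] H := (LinearEquiv.ofBijective T₀ hbT).toContinuousLinearEquivOfContinuous
      (T₀.mkContinuous _ fun x => norm_le_of_dir_eq ψ hdim (hT₀ x)).continuous
    refine ⟨T, fun A => sub_eq_iff_eq_add.1 ?_⟩
    refine op_eq_of_qf_eq (D := ψ A - ψ 0) fun z => ?_
    have h := qf_map_sub ψ hdim (T := T) (T' := ContinuousLinearMap.adjoint (T : H →L[ℂ] H))
      T.surjective (fun x z => by
        rw [ContinuousLinearMap.adjoint_inner_right]; rfl) hT₀ A z
    exact (ContinuousLinearMap.adjoint_inner_left (T : H →L[ℂ] H) _ z).symm.trans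
      ((inner_self_eq_qf (H := H) A _).trans (congrArg Complex.ofReal h.symm))
  · right
    have hbT := bijective_of_dir_eq ψ hT₀
    let T : H ≃L⋆[ℂ] H := (LinearEquiv.ofBijective T₀ hbT).toContinuousLinearEquivOfContinuous
      (T₀.mkContinuous _ fun x => norm_le_of_dir_eq ψ hdim (hT₀ x)).continuous
    refine ⟨T, fun A => sub_eq_iff_eq_add.1 ?_⟩
    refine op_eq_of_qf_eq (D := ψ A - ψ 0) fun z => ?_
    have h := qf_map_sub ψ hdim (T := T) (T' := conjAdjoint (T : H →L⋆[ℂ] H))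
      T.surjective (fun x z => by
        rw [norm_inner_symm x, conjAdjoint_inner_left]; rfl) hT₀ A z
    refine Eq.trans ?_ (congrArg Complex.ofReal h.symm)
    -- For conjugate-linear `T` the adjoint identity yields the conjugate inner product, harmless
    -- because the form is real.
    have h2 := congrArg (starRingEnd ℂ) (inner_self_eq_qf (H := H) A
      (conjAdjoint (T : H →L⋆[ℂ] H) z))
    rw [Complex.conj_ofReal, conjAdjoint_inner_left, inner_conj_symm] at h2
    exact h2
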